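/- A black box is a list $X=(x_0,\dots,x_{N-1})\in\{0,1\}^N$. A quantum network with $T$ queries works on finitely many qubits with basis states $|j,b,z\rangle$, where $j$ is an address (there are enough address qubits for all $j<N$), $b$ is a bit and $z$ is a workspace string. It prepares the state $U_TO_XU_{T-1}O_X\cdots O_XU_1O_XU_0|0,0,0\rangle$, where the $U_t$ are unitaries independent of $X$ and $O_X|j,b,z\rangle=|j,b\oplus x_j,z\rangle$ (with $x_j:=0$ for addresses $j\ge N$). Then it observes the register in the computational basis and announces a result that is a function of the observed basis state. The network *searches* if its result is an index or the answer "no": an index $j<N$ is correct iff $x_j=1$, and "no" is correct iff $X$ contains no $1$. In the *decision form* of search the result is a bit, and it is correct iff it equals $x_0\vee\dots\vee x_{N-1}$. The *error probability* $\varepsilon$ of a network is the maximum over all $X\in\{0,1\}^N$ of the probability that its result is incorrect. There are absolute constants $c>0$ and $C>0$ such that for all $N\in\mathbb N$ and all real $\alpha\ge 0$: every quantum network for search of an unordered list of $N$ items that uses $T<N$ queries with $T\le N^{1/2+\alpha}$ has error probability $$\varepsilon\ \ge\ C\cdot\frac1{2^{\,cN^{2\alpha}}},$$ that is, $\varepsilon\in\Omega\bigl(1/2^{cN^{2\alpha}}\bigr)$.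 The same holds for the decision form of search. In particular, error probability at most $1/2^N$ requires $\Omega(N)$ queries: there is an absolute constant $\kappa>0$ such that for every $N\ge 2$, every quantum network for search of a list of $N$ items (in either form) with error probability $\varepsilon\le 1/2^N$ uses at least $\kappa N$ queries. -/

import Mathlib

open scoped Matrix

noncomputable section

/-- Labels of the computational basis states `|j, b, z⟩` of a register of `a + 1 + w` qubits:
`a` address qubits (holding `j`, written as an integer below `2 ^ a`), one target qubit (holding
`b`) and `w` workspace qubits (holding `z`). -/
abbrev BasisLabel (a w : ℕ) : Type := Fin (2 ^ a) × Bool × Fin (2 ^ w)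

/-- The black box `X = (x_0, ..., x_{N-1})` read at the address `j`. Addresses `j ≥ N`, which
exist when `N` is not a power of two, carry no item: reading there gives `0`. -/
def readBit {N : ℕ} (X : Fin N → Bool) (j : ℕ) : Bool :=
  if h : j < N then X ⟨j, h⟩ else false

/-- The query gate `O`, the linear map with `O |j, b, z⟩ = |j, b ⊕ x_j, z⟩`. Since the
permutation `(j, b, z) ↦ (j, b ⊕ x_j, z)` of the basis is an involution, the amplitude of
`|j, b, z⟩` in `O ψ` is the amplitude of `|j, b ⊕ x_j, z⟩` in `ψ`. -/
def queryGate {N a w : ℕ} (X : Fin N → Bool) (ψ : BasisLabel a w → ℂ) : BasisLabel a w → ℂ :=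
  fun k => ψ (k.1, xor k.2.1 (readBit X k.1.val), k.2.2)

/-- A quantum gate network querying a black box of `N` bits, with results in `R`. It applies
`U_0`, then a query, then `U_1`, then a query, and so on up to `U_T` where `T = queries`; the
`U_t` are unitaries that do not depend on the black box (those with `t > T` are never used).
Finally the register is observed, and the basis state that is seen determines the result; an
output bit is the special case in which `out` reads one bit of the label. -/
structure QuantumNetwork (N : ℕ) (R : Type) where
  /-- number of address qubits -/
  a : ℕ
  /-- number of workspace qubits -/
  w : ℕ
  /-- every item of the list has an address -/
  items_le : N ≤ 2 ^ a
  /-- number of queries -/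
  queries : ℕ
  /-- the unitary transformations between the queries -/
  U : ℕ → Matrix.unitaryGroup (BasisLabel a w) ℂ
  /-- the result that is announced when a given basis state is observed -/
  out : BasisLabel a w → R

namespace QuantumNetwork

variable {N : ℕ} {R : Type}

/-- The state `U_t O U_{t-1} O ... O U_1 O U_0 |0⟩`. -/
def stateAfter (A : QuantumNetwork N R) (X : Fin N → Bool) : ℕ → BasisLabel A.a A.w → ℂ
  | 0 => (A.U 0).val *ᵥ Pi.single (0, false, 0) 1
  | t + 1 => (A.U (t + 1)).val *ᵥ queryGate X (A.stateAfter X t)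

/-- The final state, in which all the queries have been made. -/
def finalState (A : QuantumNetwork N R) (X : Fin N → Bool) : BasisLabel A.a A.w → ℂ :=
  A.stateAfter X A.queries

open Classical in
/-- The probability that the result on the black box `X` is not a correct one, where
`correct X r` says that `r` is a correct result for `X`. -/
def errorOn (A : QuantumNetwork N R) (correct : (Fin N → Bool) → R → Prop)
    (X : Fin N → Bool) : ℝ :=
  ∑ k : BasisLabel A.a A.w, if correct X (A.out k) then 0 else ‖A.finalState X k‖ ^ 2

/-- The error probability of a network: the maximum, over the finitely many black boxes, of the
probability of an incorrect result. -/
def error (A : QuantumNetwork N R) (correct : (Fin N → Bool) → R → Prop) : ℝ :=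
  ⨆ X : Fin N → Bool, A.errorOn correct X

end QuantumNetwork

/-- Correct results in searching: an index `j` (as `some j`) with `x_j = 1`, or the answer "no"
(as `none`) if there is no such index. -/
def SearchCorrect {N : ℕ} (X : Fin N → Bool) : Option (Fin N) → Prop
  | some j => X j = true
  | none => ∀ j, X j = false

/-- Correct results in the decision form of searching, the OR function: the bit `1` if the list
contains a `1`, and the bit `0` otherwise. -/
def OrCorrect {N : ℕ} (X : Fin N → Bool) (r : Bool) : Prop :=
  r = true ↔ ∃ j, X j = true

end

/-! Polynomial method with a dual certificate. After `T` queries every amplitude is a polynomial of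
degree at most `T` in the `x_i`. Project the final state onto the outcomes that are correct for the
zero list, giving a vector `v X`. On the zero list its squared norm is at least `1 - ε`; on every
other list it is at most `ε`, since no result is correct for both. If real weights `μ` annihilate
all polynomials of degree at most `T`, with `μ 0 = 1` and total mass `K`, then `∑ μ X • v X = 0`
gives `1 - ε ≤ (K - 1)² ε` (`one_sub_error_le`), hence `ε ≥ 1 / K²`.

It remains to find a cheap `μ`. Mixing Bernoulli product measures at quadratically spaced parameters
gives degree `M + 1` on `8M² + 4` items with mass 20 (`hasDualWitness_quadratic`). Tensoring `m`
copies on disjoint blocks multiplies length and degree by `m` and raises the mass to the power `m`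
(`HasDualWitness.nsmul`). With `m` of order `y`, blocks of length about `N / m` reach degree of
order `√(N y)` at mass `2^O(y)`; `y = N^(2α)` gives the bound. -/

noncomputable section

/-! ### Dual witnesses and their products -/

/-- The monomial `∏_{i ∈ S} x_i` as a function of the black box. -/
def monomialValue {n : ℕ} (S : Finset (Fin n)) (X : Fin n → Bool) : ℝ :=
  ∏ i ∈ S, if X i then 1 else 0

/-- A dual certificate: real weights on `{0,1}^n` with total mass at most `K` and weight `1` at the
zero list, which are orthogonal to all polynomials of degree less than `D`. -/
def HasDualWitness (n D : ℕ) (K : ℝ) : Prop :=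
  ∃ μ : (Fin n → Bool) → ℝ, μ (fun _ => false) = 1 ∧ ∑ X, |μ X| ≤ K ∧
    ∀ S : Finset (Fin n), S.card < D → ∑ X, μ X * monomialValue S X = 0

theorem monomialValue_eq_prod_univ {n : ℕ} (S : Finset (Fin n)) (X : Fin n → Bool) :
    monomialValue S X = ∏ i, if i ∈ S then (if X i then 1 else 0) else 1 := by
  rw [monomialValue, Fintype.prod_ite_mem]

theorem monomialValue_append {m n : ℕ} (S : Finset (Fin (m + n))) (X : Fin m → Bool)
    (Y : Fin n → Bool) :
    monomialValue S (Fin.append X Y) =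
      monomialValue (Finset.univ.filter fun i => Fin.castAdd n i ∈ S) X *
        monomialValue (Finset.univ.filter fun i => Fin.natAdd m i ∈ S) Y := by
  rw [monomialValue_eq_prod_univ, monomialValue_eq_prod_univ, monomialValue_eq_prod_univ,
    Fin.prod_univ_add]
  simp only [Fin.append_left, Fin.append_right, Finset.mem_filter, Finset.mem_univ, true_and]

theorem card_filter_castAdd_add_card_filter_natAdd {m n : ℕ} (S : Finset (Fin (m + n))) :
    (Finset.univ.filter fun i => Fin.castAdd n i ∈ S).card +
      (Finset.univ.filter fun i => Fin.natAdd m i ∈ S).card = S.card := by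
  rw [Finset.card_filter, Finset.card_filter,
    ← Fin.sum_univ_add (fun i => if i ∈ S then (1 : ℕ) else 0), ← Finset.card_filter]
  simp

theorem sum_append {m n : ℕ} (f : (Fin (m + n) → Bool) → ℝ) :
    ∑ Z, f Z = ∑ X : Fin m → Bool, ∑ Y : Fin n → Bool, f (Fin.append X Y) := by
  rw [← (Fin.appendEquiv m n).sum_comp, Fintype.sum_prod_type]
  rfl

/-- The tensor product of the witnesses works: a monomial splits over the two blocks, and if its
degree is below `D + E`, then one factor has degree below `D` or `E` and is annihilated. -/
theorem HasDualWitness.add {m n D E : ℕ} {K L : ℝ} (h : HasDualWitness m D K)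
    (h' : HasDualWitness n E L) : HasDualWitness (m + n) (D + E) (K * L) := by
  obtain ⟨μ, hμ0, hμK, hμ⟩ := h
  obtain ⟨ν, hν0, hνL, hν⟩ := h'
  refine ⟨fun Z => μ (fun i => Z (Fin.castAdd n i)) * ν (fun i => Z (Fin.natAdd m i)), ?_, ?_, ?_⟩
  · simp [hμ0, hν0]
  · rw [sum_append]
    simp only [Fin.append_left, Fin.append_right, abs_mul]
    rw [← Finset.sum_mul_sum]
    exact mul_le_mul hμK hνL (Finset.sum_nonneg fun _ _ => abs_nonneg _)
      ((Finset.sum_nonneg fun _ _ => abs_nonneg _).trans hμK)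
  · intro S hS
    rw [sum_append]
    simp only [Fin.append_left, Fin.append_right, monomialValue_append]
    rw [Finset.sum_congr rfl fun X _ => Finset.sum_congr rfl fun Y _ => mul_mul_mul_comm _ _ _ _,
      ← Finset.sum_mul_sum]
    rw [← card_filter_castAdd_add_card_filter_natAdd] at hS
    rcases lt_or_ge (Finset.univ.filter fun i => Fin.castAdd n i ∈ S).card D with h1 | h1
    · rw [hμ _ h1, zero_mul]
    · rw [hν _ (by omega), mul_zero]

theorem hasDualWitness_zero (n : ℕ) : HasDualWitness n 0 1 := by
  refine ⟨Pi.single (fun _ => false) 1, by simp, ?_, fun S hS => absurd hS (Nat.not_lt_zero _)⟩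
  rw [Finset.sum_eq_single (fun _ => false)]
  · simp
  · intro X _ hX
    simp [Pi.single_eq_of_ne hX]
  · simp

theorem HasDualWitness.mono {m n D : ℕ} {K : ℝ} (h : HasDualWitness m D K) (hmn : m ≤ n) :
    HasDualWitness n D K := by
  obtain ⟨k, rfl⟩ := Nat.exists_eq_add_of_le hmn
  simpa using h.add (hasDualWitness_zero k)

theorem HasDualWitness.nsmul {n D : ℕ} {K : ℝ} (h : HasDualWitness n D K) (m : ℕ) :
    HasDualWitness (m * n) (m * D) (K ^ m) := by
  induction m with
  | zero => simpa using hasDualWitness_zero 0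
  | succ m ih => simpa only [Nat.succ_mul, pow_succ] using ih.add h

theorem hasDualWitness_one : HasDualWitness 1 1 2 := by
  refine ⟨fun X => if X 0 then -1 else 1, by simp, ?_, ?_⟩
  · rw [← (Equiv.funUnique (Fin 1) Bool).symm.sum_comp]
    norm_num
  · intro S hS
    have hS : S = ∅ := by simpa using hS
    rw [← (Equiv.funUnique (Fin 1) Bool).symm.sum_comp]
    simp [hS, monomialValue]

/-! ### Bernoulli product measures -/

/-- The probability of the list `X` when the items are independent and each is `1` with
probability `t`. -/
def bernoulliWeight (n : ℕ) (t : ℝ) (X : Fin n → Bool) : ℝ :=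
  ∏ i, if X i then t else 1 - t

theorem bernoulliWeight_nonneg {n : ℕ} {t : ℝ} (h0 : 0 ≤ t) (h1 : t ≤ 1) (X : Fin n → Bool) :
    0 ≤ bernoulliWeight n t X :=
  Finset.prod_nonneg fun i _ => by split_ifs <;> linarith

theorem sum_bernoulliWeight_mul_monomialValue {n : ℕ} (t : ℝ) (S : Finset (Fin n)) :
    ∑ X, bernoulliWeight n t X * monomialValue S X = t ^ S.card := by
  have h := Finset.prod_univ_sum (fun _ : Fin n => (Finset.univ : Finset Bool))
    (fun i b => (if b then t else 1 - t) * if i ∈ S then (if b then 1 else 0) else 1)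
  rw [Fintype.piFinset_univ] at h
  simp only [bernoulliWeight, monomialValue_eq_prod_univ, ← Finset.prod_mul_distrib]
  rw [← h]
  have : ∀ i : Fin n, (∑ b : Bool, (if b then t else 1 - t) *
      if i ∈ S then (if b then (1 : ℝ) else 0) else 1) = if i ∈ S then t else 1 := by
    intro i
    by_cases hi : i ∈ S <;> simp [hi]
  rw [Finset.prod_congr rfl fun i _ => this i, Fintype.prod_ite_mem]
  simp

theorem sum_abs_bernoulliWeight {n : ℕ} {t : ℝ} (h0 : 0 ≤ t) (h1 : t ≤ 1) :
    ∑ X, |bernoulliWeight n t X| = 1 := by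
  have h := sum_bernoulliWeight_mul_monomialValue (n := n) t ∅
  simp only [monomialValue, Finset.prod_empty, mul_one, Finset.card_empty, pow_zero] at h
  rw [← h]
  exact Finset.sum_congr rfl fun X _ => abs_of_nonneg (bernoulliWeight_nonneg h0 h1 X)

theorem bernoulliWeight_false (n : ℕ) (t : ℝ) :
    bernoulliWeight n t (fun _ => false) = (1 - t) ^ n := by
  simp [bernoulliWeight]

/-! ### Interpolation at quadratically spaced nodes -/

theorem alternating_sum_choose_mul_eval {n : ℕ} (P : Polynomial ℝ) (hP : P.natDegree < n) (y : ℝ) :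
    ∑ j ∈ Finset.range (n + 1), (-1 : ℝ) ^ j * n.choose j * P.eval (y + j) = 0 := by
  have h := congrFun (Polynomial.fwdDiff_iter_eq_zero_of_degree_lt hP) y
  rw [fwdDiff_iter_eq_sum_shift] at h
  have h2 := congrArg (fun z => (-1 : ℝ) ^ n * z) h
  simp only [Finset.mul_sum, Pi.zero_apply, mul_zero] at h2
  rw [← h2]
  refine Finset.sum_congr rfl fun j hj => ?_
  have hj : j ≤ n := Nat.lt_succ_iff.mp (Finset.mem_range.mp hj)
  have : (-1 : ℝ) ^ n * (-1) ^ (n - j) = (-1) ^ j := by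
    obtain ⟨k, rfl⟩ := Nat.exists_eq_add_of_le hj
    rw [Nat.add_sub_cancel_left, pow_add, mul_assoc, ← mul_pow]
    simp
  rw [← this]
  simp only [zsmul_eq_mul, nsmul_eq_mul, mul_one]
  push_cast
  ring

/-- The interpolation nodes `2 (j - M)²`, for `j = 0, ..., 2M`. -/
def quadraticNode (M j : ℕ) : ℝ := 2 * ((j : ℝ) - M) ^ 2

/-- The interpolation weights at the nodes `2 (j - M)²`, normalised at `j = M`. -/
def quadraticWeight (M j : ℕ) : ℝ :=
  (-1) ^ (j + M) * ((2 * M).choose j / (2 * M).choose M) * (1 / (1 - quadraticNode M j))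

theorem one_le_sub_sq {M j : ℕ} (h : j ≠ M) : 1 ≤ ((j : ℝ) - M) ^ 2 := by
  have : (1 : ℤ) ≤ ((j : ℤ) - M) ^ 2 := by
    have : (j : ℤ) - M ≠ 0 := by omega
    have := pow_pos (abs_pos.mpr this) 2
    rw [sq_abs] at this
    omega
  exact_mod_cast this

theorem quadraticWeight_self (M : ℕ) : quadraticWeight M M = 1 := by
  have : ((2 * M).choose M : ℝ) ≠ 0 := by
    exact_mod_cast (Nat.choose_pos (by omega)).ne'
  simp [quadraticWeight, quadraticNode, this, ← two_mul]

/-- The central binomial coefficient dominates, and the factor 2 in the nodes gives `2d² - 1 ≥ d²`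
for a nonzero integer `d = j - M`; in particular no node equals 1. -/
theorem abs_quadraticWeight_le {M j : ℕ} (h : j ≠ M) :
    |quadraticWeight M j| ≤ 1 / ((j : ℝ) - M) ^ 2 := by
  have hj := one_le_sub_sq h
  have hpos : (0 : ℝ) < (2 * M).choose M := by
    exact_mod_cast Nat.choose_pos (by omega)
  rw [quadraticWeight, abs_mul, abs_mul, abs_pow, abs_neg, abs_one, one_pow, one_mul]
  have h1 : |((2 * M).choose j / (2 * M).choose M : ℝ)| ≤ 1 := by
    rw [abs_of_nonneg (by positivity), div_le_one hpos]
    have := Nat.choose_le_centralBinom j M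
    rw [Nat.centralBinom] at this
    exact_mod_cast this
  have h2 : |1 / (1 - quadraticNode M j)| ≤ 1 / ((j : ℝ) - M) ^ 2 := by
    rw [abs_div, abs_one, abs_sub_comm, quadraticNode, abs_of_nonneg (by linarith)]
    exact one_div_le_one_div_of_le (by linarith) (by linarith)
  calc _ ≤ 1 * (1 / ((j : ℝ) - M) ^ 2) := mul_le_mul h1 h2 (abs_nonneg _) zero_le_one
    _ = _ := one_mul _

theorem sum_one_div_succ_sq_le (M : ℕ) :
    ∑ i ∈ Finset.range M, 1 / ((i : ℝ) + 1) ^ 2 ≤ 2 := by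
  have key : ∀ m : ℕ, ∑ i ∈ Finset.range (m + 1), 1 / ((i : ℝ) + 1) ^ 2 ≤ 2 - 1 / ((m : ℝ) + 1) := by
    intro m
    induction m with
    | zero => norm_num
    | succ m ih =>
      rw [Finset.sum_range_succ]
      have : 1 / (((m + 1 : ℕ) : ℝ) + 1) ^ 2 ≤ 1 / ((m : ℝ) + 1) - 1 / (((m + 1 : ℕ) : ℝ) + 1) := by
        push_cast
        rw [div_sub_div _ _ (by positivity) (by positivity),
          div_le_div_iff₀ (by positivity) (by positivity)]
        nlinarith [(Nat.cast_nonneg m : (0 : ℝ) ≤ m)]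
      linarith
  rcases M with _ | m
  · norm_num
  · have : (0 : ℝ) ≤ 1 / ((m : ℝ) + 1) := by positivity
    linarith [key m]

theorem sum_abs_quadraticWeight_le (M : ℕ) :
    ∑ j ∈ Finset.range (2 * M + 1), |quadraticWeight M j| ≤ 5 := by
  have e : 2 * M + 1 = M + (1 + M) := by ring
  rw [e, Finset.sum_range_add, Finset.sum_range_add, Finset.sum_range_one, Nat.add_zero,
    quadraticWeight_self, ← Finset.sum_range_reflect]
  have h1 : ∑ j ∈ Finset.range M, |quadraticWeight M (M - 1 - j)| ≤ 2 := by
    refine (Finset.sum_le_sum fun j hj => ?_).trans (sum_one_div_succ_sq_le M)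
    have hj := Finset.mem_range.mp hj
    refine (abs_quadraticWeight_le (by omega)).trans (le_of_eq ?_)
    rw [Nat.sub_sub, Nat.cast_sub (by omega)]
    push_cast
    ring
  have h2 : ∑ j ∈ Finset.range M, |quadraticWeight M (M + (1 + j))| ≤ 2 := by
    refine (Finset.sum_le_sum fun j hj => ?_).trans (sum_one_div_succ_sq_le M)
    refine (abs_quadraticWeight_le (by omega)).trans (le_of_eq ?_)
    push_cast
    ring
  rw [abs_one]
  linarith

/-- Dividing `q^k - 1` by `1 - q` leaves minus a geometric sum in `q`, a polynomial of degree `2(k -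
1) < 2M` in `j`, which the alternating binomial sum of order `2M` kills. The `-1` stands for an
extra node at `q = 1`. -/
theorem sum_quadraticWeight_mul_pow_sub_one {M k : ℕ} (hk : k ≤ M) :
    ∑ j ∈ Finset.range (2 * M + 1), quadraticWeight M j * (quadraticNode M j ^ k - 1) = 0 := by
  rcases Nat.eq_zero_or_pos k with rfl | hk0
  · simp
  let Q : Polynomial ℝ := ∑ l ∈ Finset.range k, Polynomial.X ^ l
  let P : Polynomial ℝ := Q.comp (2 * Polynomial.X ^ 2)
  have hQ : Q.natDegree ≤ k - 1 := by
    refine Polynomial.natDegree_sum_le_of_forall_le _ _ fun l hl => ?_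
    rw [Polynomial.natDegree_X_pow]
    have := Finset.mem_range.mp hl
    omega
  have hX : (2 * Polynomial.X ^ 2 : Polynomial ℝ).natDegree ≤ 2 := by
    refine Polynomial.natDegree_mul_le.trans ?_
    simp
  have hP : P.natDegree < 2 * M := by
    have : P.natDegree ≤ (k - 1) * 2 := Polynomial.natDegree_comp_le.trans (Nat.mul_le_mul hQ hX)
    omega
  have h := alternating_sum_choose_mul_eval P hP (-(M : ℝ))
  have h2 := congrArg (fun z => -((-1 : ℝ) ^ M / (2 * M).choose M) * z) h
  simp only [Finset.mul_sum, mul_zero] at h2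
  rw [← h2]
  refine Finset.sum_congr rfl fun j _ => ?_
  have hx : 1 - quadraticNode M j ≠ 0 := by
    rw [quadraticNode]
    rcases eq_or_ne j M with rfl | hj
    · simp
    · have := one_le_sub_sq hj
      linarith
  have hev : P.eval (-(M : ℝ) + j) = ∑ l ∈ Finset.range k, quadraticNode M j ^ l := by
    simp only [P, Q, Polynomial.eval_comp, Polynomial.eval_finsetSum, Polynomial.eval_pow,
      Polynomial.eval_X, Polynomial.eval_mul, Polynomial.eval_ofNat, quadraticNode]
    rw [neg_add_eq_sub]
  rw [hev, ← geom_sum_mul, quadraticWeight, pow_add]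
  field_simp
  ring

theorem hasDualWitness_quadratic (M : ℕ) : HasDualWitness (8 * M ^ 2 + 4) (M + 1) 20 := by
  -- The parameters are `s` times the nodes, with `s = 4 / n`. The largest is `8M² / n`, so this
  -- length keeps all of them, and `s` itself, in `[0, 1]`.
  set n : ℕ := 8 * M ^ 2 + 4 with hn
  have hnR : (n : ℝ) = 8 * (M : ℝ) ^ 2 + 4 := by rw [hn]; push_cast; ring
  have hnpos : (0 : ℝ) < n := by rw [hnR]; positivity
  let t : ℕ → ℝ := fun j => 4 * quadraticNode M j / n
  let s : ℝ := 4 / n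
  have hs0 : 0 ≤ s := by positivity
  have hs1 : s ≤ 1 := by
    rw [div_le_one hnpos, hnR]
    nlinarith [sq_nonneg (M : ℝ)]
  have ht0 : ∀ j, 0 ≤ t j := fun j => by
    simp only [t, quadraticNode]; positivity
  have ht1 : ∀ j ∈ Finset.range (2 * M + 1), t j ≤ 1 := by
    intro j hj
    have hj : (j : ℝ) ≤ 2 * M := by
      exact_mod_cast Nat.lt_succ_iff.mp (Finset.mem_range.mp hj)
    rw [div_le_one hnpos, hnR, quadraticNode]
    nlinarith [mul_nonneg (Nat.cast_nonneg j : (0 : ℝ) ≤ j) (sub_nonneg.mpr hj)]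
  have hexp : ∀ x : ℝ, s ≤ x → x ≤ 1 → (1 - x) ^ n ≤ 1 / 10 := by
    intro x hx hx1
    calc (1 - x) ^ n ≤ Real.exp (-s) ^ n := by
          refine pow_le_pow_left₀ (by linarith) ?_ n
          linarith [Real.add_one_le_exp (-s)]
      _ = (Real.exp 1 ^ 4)⁻¹ := by
          rw [← Real.exp_nat_mul, ← Real.exp_nat_mul, ← Real.exp_neg]
          congr 1
          simp only [s]
          field_simp
          norm_num
      _ ≤ 1 / 10 := by
          rw [one_div]
          refine inv_anti₀ (by norm_num) ?_
          calc (10 : ℝ) ≤ 2 ^ 4 := by norm_num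
            _ ≤ _ := pow_le_pow_left₀ (by norm_num) (by linarith [Real.add_one_le_exp 1]) 4
  let μ : (Fin n → Bool) → ℝ := fun X => ∑ j ∈ Finset.range (2 * M + 1),
    quadraticWeight M j * (bernoulliWeight n (t j) X - bernoulliWeight n s X)
  have hμS : ∀ S : Finset (Fin n), S.card < M + 1 → ∑ X, μ X * monomialValue S X = 0 := by
    intro S hS
    simp only [μ, Finset.sum_mul]
    rw [Finset.sum_comm]
    have h := sum_quadraticWeight_mul_pow_sub_one (Nat.lt_succ_iff.mp hS)
    have h2 := congrArg (fun z => s ^ S.card * z) h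
    simp only [Finset.mul_sum, mul_zero] at h2
    rw [← h2]
    refine Finset.sum_congr rfl fun j _ => ?_
    simp only [mul_assoc, sub_mul, ← Finset.mul_sum, Finset.sum_sub_distrib,
      sum_bernoulliWeight_mul_monomialValue]
    have : t j = s * quadraticNode M j := by simp only [t, s]; ring
    rw [this, mul_pow]
    ring
  have hμK : ∑ X, |μ X| ≤ 10 := by
    calc ∑ X, |μ X| ≤ ∑ X, ∑ j ∈ Finset.range (2 * M + 1), |quadraticWeight M j| *
            (|bernoulliWeight n (t j) X| + |bernoulliWeight n s X|) := by
          refine Finset.sum_le_sum fun X _ => (Finset.abs_sum_le_sum_abs _ _).trans ?_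
          refine Finset.sum_le_sum fun j _ => ?_
          rw [abs_mul]
          exact mul_le_mul_of_nonneg_left (abs_sub _ _) (abs_nonneg _)
      _ = ∑ j ∈ Finset.range (2 * M + 1), |quadraticWeight M j| * 2 := by
          rw [Finset.sum_comm]
          refine Finset.sum_congr rfl fun j hj => ?_
          rw [← Finset.mul_sum, Finset.sum_add_distrib, sum_abs_bernoulliWeight (ht0 j) (ht1 j hj),
            sum_abs_bernoulliWeight hs0 hs1]
          norm_num
      _ ≤ 10 := by
          rw [← Finset.sum_mul]
          linarith [sum_abs_quadraticWeight_le M]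
  -- The node `j = M` is the point mass at the zero list and contributes at least `1 - 1/10`. The
  -- others have total weight at most `5 - 1 = 4` and contribute at most `4/10`. Normalising turns
  -- mass 10 into 20.
  have hμ0 : 1 / 2 ≤ μ (fun _ => false) := by
    have hM : M ∈ Finset.range (2 * M + 1) := Finset.mem_range.mpr (by omega)
    have hsplit : ∀ f : ℕ → ℝ, ∑ j ∈ Finset.range (2 * M + 1), f j =
        f M + ∑ j ∈ (Finset.range (2 * M + 1)).erase M, f j := fun f =>
      (Finset.add_sum_erase _ f hM).symm
    have hrest : |∑ j ∈ (Finset.range (2 * M + 1)).erase M, quadraticWeight M j *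
        ((1 - t j) ^ n - (1 - s) ^ n)| ≤ 4 * (1 / 10) := by
      have h5 := sum_abs_quadraticWeight_le M
      rw [hsplit, quadraticWeight_self, abs_one] at h5
      calc _ ≤ ∑ j ∈ (Finset.range (2 * M + 1)).erase M, |quadraticWeight M j| * (1 / 10) := by
            refine (Finset.abs_sum_le_sum_abs _ _).trans (Finset.sum_le_sum fun j hj => ?_)
            rw [abs_mul]
            refine mul_le_mul_of_nonneg_left ?_ (abs_nonneg _)
            have hjM := Finset.ne_of_mem_erase hj
            have ht := ht1 j (Finset.mem_of_mem_erase hj)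
            have hst : s ≤ t j := by
              refine div_le_div_of_nonneg_right ?_ hnpos.le
              rw [quadraticNode]
              linarith [one_le_sub_sq hjM]
            have e1 := hexp _ hst ht
            have e2 := hexp s le_rfl hs1
            have e3 : 0 ≤ (1 - t j) ^ n := pow_nonneg (by linarith) n
            have e4 : 0 ≤ (1 - s) ^ n := pow_nonneg (by linarith) n
            rw [abs_le]
            constructor <;> linarith
        _ ≤ _ := by
            rw [← Finset.sum_mul]
            linarith
    simp only [μ, bernoulliWeight_false]
    rw [hsplit, quadraticWeight_self]
    have e2 := hexp s le_rfl hs1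
    have tM : t M = 0 := by simp [t, quadraticNode]
    rw [tM, sub_zero, one_pow, one_mul]
    linarith [(abs_le.mp hrest).1]
  have hpos : 0 < μ (fun _ => false) := by linarith
  refine ⟨fun X => μ X / μ (fun _ => false), div_self hpos.ne', ?_, ?_⟩
  · simp only [abs_div, abs_of_pos hpos]
    rw [← Finset.sum_div, div_le_iff₀ hpos]
    linarith
  · intro S hS
    simp only [div_mul_eq_mul_div]
    rw [← Finset.sum_div, hμS S hS, zero_div]

/-! ### Amplitudes as polynomials in the black box -/

/-- Complex functions of the black box that are polynomials of degree at most `d`. -/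
def polynomialsOfDegreeLE (N d : ℕ) : Submodule ℂ ((Fin N → Bool) → ℂ) :=
  Submodule.span ℂ {f | ∃ S : Finset (Fin N), S.card ≤ d ∧ f = fun X => (monomialValue S X : ℂ)}

theorem polynomialsOfDegreeLE_mono {N d e : ℕ} (h : d ≤ e) :
    polynomialsOfDegreeLE N d ≤ polynomialsOfDegreeLE N e :=
  Submodule.span_mono fun _ ⟨S, hS, hf⟩ => ⟨S, hS.trans h, hf⟩

theorem const_mem_polynomialsOfDegreeLE (N d : ℕ) (z : ℂ) :
    (fun _ => z) ∈ polynomialsOfDegreeLE N d := by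
  have : (fun _ : Fin N → Bool => z) = z • fun X => (monomialValue ∅ X : ℂ) := by
    ext X; simp [monomialValue]
  rw [this]
  exact Submodule.smul_mem _ _ (Submodule.subset_span ⟨∅, by simp, rfl⟩)

theorem monomialValue_insert {N : ℕ} (i : Fin N) (S : Finset (Fin N)) (X : Fin N → Bool) :
    monomialValue (insert i S) X = if X i then monomialValue S X else 0 := by
  by_cases hi : i ∈ S
  · rw [Finset.insert_eq_of_mem hi]
    by_cases hX : X i = true
    · simp [hX]
    · rw [if_neg hX, monomialValue, Finset.prod_eq_zero hi]
      simp [hX]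
  · rw [monomialValue, Finset.prod_insert hi, monomialValue]
    by_cases hX : X i = true <;> simp [hX]

theorem ite_mem_polynomialsOfDegreeLE {N d : ℕ} {f : (Fin N → Bool) → ℂ} (i : Fin N)
    (hf : f ∈ polynomialsOfDegreeLE N d) :
    (fun X => if X i then f X else 0) ∈ polynomialsOfDegreeLE N (d + 1) := by
  induction hf using Submodule.span_induction with
  | mem f h =>
    obtain ⟨S, hS, rfl⟩ := h
    refine Submodule.subset_span ⟨insert i S, (Finset.card_insert_le i S).trans (by omega), ?_⟩
    ext X
    rw [monomialValue_insert]
    split_ifs <;> simp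
  | zero =>
    convert Submodule.zero_mem (polynomialsOfDegreeLE N (d + 1)) using 1
    ext X; simp
  | add f g _ _ hf hg =>
    convert Submodule.add_mem _ hf hg using 1
    ext X
    by_cases hX : X i = true <;> simp [hX]
  | smul z f _ hf =>
    convert Submodule.smul_mem _ z hf using 1
    ext X
    by_cases hX : X i = true <;> simp [hX]

theorem sum_mul_eq_zero_of_mem_polynomialsOfDegreeLE {N d D : ℕ} {f : (Fin N → Bool) → ℂ}
    {μ : (Fin N → Bool) → ℝ} (hf : f ∈ polynomialsOfDegreeLE N d) (hd : d < D)
    (hμ : ∀ S : Finset (Fin N), S.card < D → ∑ X, μ X * monomialValue S X = 0) :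
    ∑ X, (μ X : ℂ) * f X = 0 := by
  induction hf using Submodule.span_induction with
  | mem f h =>
    obtain ⟨S, hS, rfl⟩ := h
    beta_reduce
    exact_mod_cast hμ S (by omega)
  | zero => simp
  | add f g _ _ hf hg => simp [mul_add, Finset.sum_add_distrib, hf, hg]
  | smul z f _ hf =>
    simp only [Pi.smul_apply, smul_eq_mul, mul_left_comm _ z, ← Finset.mul_sum, hf, mul_zero]

/-- At an address `i < N` the new amplitude is `ψ_b + x_i (ψ_{¬b} - ψ_b)`, which costs one degree.
-/
theorem queryGate_mem_polynomialsOfDegreeLE {N a w d : ℕ}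
    {ψ : (Fin N → Bool) → BasisLabel a w → ℂ}
    (hψ : ∀ k, (fun X => ψ X k) ∈ polynomialsOfDegreeLE N d) (k : BasisLabel a w) :
    (fun X => queryGate X (ψ X) k) ∈ polynomialsOfDegreeLE N (d + 1) := by
  have hle := polynomialsOfDegreeLE_mono (N := N) (Nat.le_succ d)
  by_cases h : k.1.val < N
  · let i : Fin N := ⟨k.1.val, h⟩
    have h1 := hψ (k.1, k.2.1, k.2.2)
    have h2 := hψ (k.1, !k.2.1, k.2.2)
    convert Submodule.add_mem _ (hle h1)
      (ite_mem_polynomialsOfDegreeLE i (Submodule.sub_mem _ h2 h1)) using 1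
    ext X
    by_cases hX : X i = true <;> simp [queryGate, readBit, h, i, hX]
  · convert hle (hψ (k.1, k.2.1, k.2.2)) using 1
    ext X
    simp [queryGate, readBit, h]

theorem mulVec_mem_polynomialsOfDegreeLE {N d : ℕ} {κ : Type*} [Fintype κ] (U : Matrix κ κ ℂ)
    {ψ : (Fin N → Bool) → κ → ℂ} (hψ : ∀ k, (fun X => ψ X k) ∈ polynomialsOfDegreeLE N d) (k : κ) :
    (fun X => (U *ᵥ ψ X) k) ∈ polynomialsOfDegreeLE N d := by
  convert Submodule.sum_mem (polynomialsOfDegreeLE N d) (t := Finset.univ)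
    fun l _ => Submodule.smul_mem _ (U k l) (hψ l) using 1
  ext X
  simp [Matrix.mulVec, dotProduct]

/-! ### Error bounds from dual witnesses -/

namespace QuantumNetwork

variable {N : ℕ} {R : Type}

theorem stateAfter_mem_polynomialsOfDegreeLE (A : QuantumNetwork N R) (t : ℕ)
    (k : BasisLabel A.a A.w) : (fun X => A.stateAfter X t k) ∈ polynomialsOfDegreeLE N t := by
  induction t generalizing k with
  | zero =>
    exact mulVec_mem_polynomialsOfDegreeLE _
      (ψ := fun _ => Pi.single (0, false, 0) 1)
      (fun l => const_mem_polynomialsOfDegreeLE N 0 _) k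
  | succ t ih =>
    exact mulVec_mem_polynomialsOfDegreeLE _ (queryGate_mem_polynomialsOfDegreeLE ih) k

theorem sum_norm_sq_mulVec {κ : Type*} [Fintype κ] [DecidableEq κ] (U : Matrix.unitaryGroup κ ℂ)
    (ψ : κ → ℂ) : ∑ k, ‖(U.val *ᵥ ψ) k‖ ^ 2 = ∑ k, ‖ψ k‖ ^ 2 := by
  have key : ∀ φ : κ → ℂ, ((∑ k, ‖φ k‖ ^ 2 : ℝ) : ℂ) = star φ ⬝ᵥ φ := by
    intro φ
    simp [dotProduct, Complex.conj_mul']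
  have : ((∑ k, ‖(U.val *ᵥ ψ) k‖ ^ 2 : ℝ) : ℂ) = ((∑ k, ‖ψ k‖ ^ 2 : ℝ) : ℂ) := by
    rw [key, key, Matrix.star_mulVec, ← Matrix.dotProduct_mulVec, Matrix.mulVec_mulVec,
      ← Matrix.star_eq_conjTranspose, Matrix.UnitaryGroup.star_mul_self, Matrix.one_mulVec]
  exact_mod_cast this

theorem sum_norm_sq_queryGate {a w : ℕ} (X : Fin N → Bool) (ψ : BasisLabel a w → ℂ) :
    ∑ k, ‖queryGate X ψ k‖ ^ 2 = ∑ k, ‖ψ k‖ ^ 2 := by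
  have hinv : Function.Involutive fun k : BasisLabel a w =>
      ((k.1, xor k.2.1 (readBit X k.1.val), k.2.2) : BasisLabel a w) := by
    rintro ⟨j, b, z⟩
    simp
  exact Equiv.sum_comp hinv.toPerm fun k => ‖ψ k‖ ^ 2

theorem sum_norm_sq_stateAfter (A : QuantumNetwork N R) (X : Fin N → Bool) (t : ℕ) :
    ∑ k, ‖A.stateAfter X t k‖ ^ 2 = 1 := by
  induction t with
  | zero =>
    rw [stateAfter, sum_norm_sq_mulVec, Finset.sum_eq_single (0, false, 0)]
    · simp
    · intro k _ hk
      simp [Pi.single_eq_of_ne hk]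
    · simp
  | succ t ih => rw [stateAfter, sum_norm_sq_mulVec, sum_norm_sq_queryGate, ih]

theorem errorOn_le_error (A : QuantumNetwork N R) (correct : (Fin N → Bool) → R → Prop)
    (X : Fin N → Bool) : A.errorOn correct X ≤ A.error correct :=
  le_ciSup (Set.finite_range _).bddAbove X

/-- A network whose correct results on the zero list are incorrect on every other list has
error bounded below by any dual witness of degree exceeding the number of queries. -/
theorem one_sub_error_le (A : QuantumNetwork N R) (correct : (Fin N → Bool) → R → Prop)
    (hcorrect : ∀ X r, correct (fun _ => false) r → correct X r → X = fun _ => false)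
    {D : ℕ} {K : ℝ} (hK : HasDualWitness N D K) (hD : A.queries < D) :
    1 - A.error correct ≤ (K - 1) ^ 2 * A.error correct := by
  classical
  obtain ⟨μ, hμ0, hμK, hμ⟩ := hK
  set z : Fin N → Bool := fun _ => false with hz
  set ε := A.error correct with hε
  -- Using the vector of amplitudes rather than the acceptance probability keeps the degree at `T`
  -- instead of `2T`.
  let v : (Fin N → Bool) → EuclideanSpace ℂ (BasisLabel A.a A.w) := fun X =>
    WithLp.toLp 2 fun k => if correct z (A.out k) then A.finalState X k else 0
  have hv : ∀ X, ‖v X‖ ^ 2 = ∑ k, if correct z (A.out k) then ‖A.finalState X k‖ ^ 2 else 0 := by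
    intro X
    rw [EuclideanSpace.norm_sq_eq]
    refine Finset.sum_congr rfl fun k _ => ?_
    by_cases h : correct z (A.out k) <;> simp [v, h]
  have hvz : 1 - ε ≤ ‖v z‖ ^ 2 := by
    have h1 := A.sum_norm_sq_stateAfter z A.queries
    have h2 : A.errorOn correct z ≤ ε := A.errorOn_le_error correct z
    have h3 : ‖v z‖ ^ 2 + A.errorOn correct z = 1 := by
      rw [hv, errorOn, ← Finset.sum_add_distrib, ← h1]
      refine Finset.sum_congr rfl fun k _ => ?_
      by_cases h : correct z (A.out k) <;> simp [h, finalState]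
    linarith
  have hvX : ∀ X, X ≠ z → ‖v X‖ ^ 2 ≤ ε := by
    intro X hX
    refine le_trans ?_ (A.errorOn_le_error correct X)
    rw [hv, errorOn]
    refine Finset.sum_le_sum fun k _ => ?_
    by_cases h : correct z (A.out k)
    · rw [if_pos h, if_neg fun h' => hX (hcorrect X _ h h')]
    · rw [if_neg h]
      split_ifs <;> positivity
  have hε0 : 0 ≤ ε := by
    refine le_trans (Finset.sum_nonneg fun k _ => ?_) (A.errorOn_le_error correct z)
    split_ifs <;> positivity
  have hsum : ∑ X, (μ X : ℂ) • v X = 0 := by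
    ext k
    have := sum_mul_eq_zero_of_mem_polynomialsOfDegreeLE
      (A.stateAfter_mem_polynomialsOfDegreeLE A.queries k) hD hμ
    by_cases h : correct z (A.out k)
    · simpa [v, h, finalState] using this
    · simp [v, h]
  rw [← Finset.add_sum_erase _ _ (Finset.mem_univ z)] at hsum hμK
  rw [hμ0, Complex.ofReal_one, one_smul, add_eq_zero_iff_eq_neg] at hsum
  rw [hμ0, abs_one] at hμK
  have hnorm : ‖v z‖ ≤ (K - 1) * √ε := by
    rw [hsum, norm_neg]
    calc _ ≤ ∑ X ∈ Finset.univ.erase z, |μ X| * √ε := by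
          refine (norm_sum_le _ _).trans (Finset.sum_le_sum fun X hX => ?_)
          rw [norm_smul, Complex.norm_real, Real.norm_eq_abs]
          exact mul_le_mul_of_nonneg_left
            (Real.le_sqrt_of_sq_le (hvX X (Finset.ne_of_mem_erase hX))) (abs_nonneg _)
      _ ≤ _ := by
          rw [← Finset.sum_mul]
          exact mul_le_mul_of_nonneg_right (by linarith) (Real.sqrt_nonneg _)
  calc 1 - ε ≤ ‖v z‖ ^ 2 := hvz
    _ ≤ ((K - 1) * √ε) ^ 2 := pow_le_pow_left₀ (norm_nonneg _) hnorm 2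
    _ = _ := by rw [mul_pow, Real.sq_sqrt hε0]

theorem one_div_sq_le_error (A : QuantumNetwork N R) (correct : (Fin N → Bool) → R → Prop)
    (hcorrect : ∀ X r, correct (fun _ => false) r → correct X r → X = fun _ => false)
    {D : ℕ} {K : ℝ} (hK : HasDualWitness N D K) (hK1 : 1 ≤ K) (hD : A.queries < D) :
    1 / K ^ 2 ≤ A.error correct := by
  have h := A.one_sub_error_le correct hcorrect hK hD
  rw [div_le_iff₀ (by positivity)]
  by_contra hlt
  have hε : A.error correct * K ^ 2 < 1 := not_le.mp hlt
  rcases le_or_gt 0 (A.error correct) with h0 | h0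
  · nlinarith
  · nlinarith [sq_nonneg (K - 1), mul_nonneg (sq_nonneg (K - 1)) (neg_nonneg.mpr h0.le)]

end QuantumNetwork

/-! ### Choice of parameters -/

theorem exists_hasDualWitness {N T : ℕ} {y : ℝ} (hy : 1 ≤ y) (hT : T < N)
    (hTy : (T : ℝ) ^ 2 ≤ N * y) :
    ∃ (D : ℕ) (K : ℝ), HasDualWitness N D K ∧ T < D ∧ 1 ≤ K ∧ K ^ 2 ≤ (2 : ℝ) ^ (117 * y) := by
  have hpow : ∀ {b : ℝ} {m r : ℕ}, 1 ≤ b → b ≤ 2 ^ r → (r * m : ℝ) ≤ 117 * y →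
      b ^ m ≤ (2 : ℝ) ^ (117 * y) := by
    intro b m r hb hbr hrm
    calc b ^ m ≤ (2 ^ r) ^ m := pow_le_pow_left₀ (by linarith) hbr m
      _ = (2 : ℝ) ^ ((r * m : ℕ) : ℝ) := by rw [Real.rpow_natCast, pow_mul]
      _ ≤ _ := Real.rpow_le_rpow_of_exponent_le (by norm_num) (by push_cast; exact hrm)
  -- The 12 absorbs `8(M + 1)² + 4 ≤ 12(M + 1)²` below. Since `m < 12y + 1 ≤ 13y` and `20² ≤ 2⁹`,
  -- the exponent is at most `9 · 13 y = 117 y`.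
  set m := ⌈12 * y⌉₊ with hm
  have hm1 : 12 * y ≤ m := Nat.le_ceil _
  have hm2 : (m : ℝ) < 12 * y + 1 := Nat.ceil_lt_add_one (by linarith)
  have hNpos : (0 : ℝ) < N := by exact_mod_cast (Nat.zero_le T).trans_lt hT
  rcases lt_or_ge N (4 * m) with hcase | hcase
  · have hcase : (N : ℝ) < 4 * m := by exact_mod_cast hcase
    -- Too few items for `m` blocks of length at least 4: the parity sign `∏ (-1)^{x_i}` has full
    -- degree `N`, and its mass is affordable because `2N < 8m`.
    refine ⟨N, 2 ^ N, by simpa using hasDualWitness_one.nsmul N, hT, one_le_pow₀ (by norm_num), ?_⟩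
    rw [← pow_mul, mul_comm N 2, pow_mul]
    refine hpow (r := 2) (by norm_num) (by norm_num) ?_
    push_cast
    linarith
  -- The largest block size that fits; `M = 0` is admissible because `4m ≤ N`.
  · set M := Nat.findGreatest (fun M => m * (8 * M ^ 2 + 4) ≤ N) N with hMdef
    have hM : m * (8 * M ^ 2 + 4) ≤ N :=
      Nat.findGreatest_spec (P := fun M => m * (8 * M ^ 2 + 4) ≤ N) (Nat.zero_le N) (by omega)
    have hm0 : 0 < m := by
      have : (0 : ℝ) < m := by linarith
      exact_mod_cast this
    have hM' : N < m * (8 * (M + 1) ^ 2 + 4) := by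
      by_contra hle
      have hle := not_lt.mp hle
      have h1 : M + 1 ≤ N := by nlinarith [sq_nonneg (M + 1), sq_nonneg M]
      have := Nat.le_findGreatest (P := fun M => m * (8 * M ^ 2 + 4) ≤ N) h1 hle
      omega
    refine ⟨m * (M + 1), 20 ^ m, ((hasDualWitness_quadratic M).nsmul m).mono hM, ?_,
      one_le_pow₀ (by norm_num), ?_⟩
    · have hM' : (N : ℝ) < m * (8 * ((M : ℝ) + 1) ^ 2 + 4) := by exact_mod_cast hM'
      have hmpos : (0 : ℝ) < m := by exact_mod_cast hm0
      have hMsq : (1 : ℝ) ≤ ((M : ℝ) + 1) ^ 2 := by nlinarith [(Nat.cast_nonneg M : (0 : ℝ) ≤ M)]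
      have h1 : (N : ℝ) < 12 * (m * ((M : ℝ) + 1) ^ 2) := by
        nlinarith [mul_le_mul_of_nonneg_left hMsq hmpos.le]
      have h2 : (T : ℝ) ^ 2 < (m * ((M : ℝ) + 1)) ^ 2 := by
        calc (T : ℝ) ^ 2 ≤ N * y := hTy
          _ ≤ N * (m / 12) := mul_le_mul_of_nonneg_left (by linarith) hNpos.le
          _ < 12 * (m * ((M : ℝ) + 1) ^ 2) * (m / 12) :=
            mul_lt_mul_of_pos_right h1 (by positivity)
          _ = _ := by ring
      have h3 := lt_of_pow_lt_pow_left₀ 2 (by positivity) h2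
      exact_mod_cast h3
    · rw [← pow_mul, mul_comm m 2, pow_mul]
      refine hpow (r := 9) (by norm_num) (by norm_num) ?_
      push_cast
      linarith

/-! ### Application to search and OR -/

theorem searchCorrect_zero_unique {N : ℕ} (X : Fin N → Bool) (r : Option (Fin N))
    (h0 : SearchCorrect (fun _ => false) r) (hX : SearchCorrect X r) : X = fun _ => false := by
  cases r with
  | none => exact funext hX
  | some j => exact absurd h0 (by simp [SearchCorrect])

theorem orCorrect_zero_unique {N : ℕ} (X : Fin N → Bool) (r : Bool)
    (h0 : OrCorrect (fun _ : Fin N => false) r) (hX : OrCorrect X r) : X = fun _ => false := by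
  have hr : r ≠ true := fun hr => by simpa using h0.mp hr
  funext j
  by_contra hj
  exact hr (hX.mpr ⟨j, by simpa using hj⟩)

theorem error_ge_of_sq_queries_le {N : ℕ} {R : Type} (A : QuantumNetwork N R)
    (correct : (Fin N → Bool) → R → Prop)
    (hcorrect : ∀ X r, correct (fun _ => false) r → correct X r → X = fun _ => false)
    {y : ℝ} (hy : 1 ≤ y) (hT : A.queries < N) (hTy : (A.queries : ℝ) ^ 2 ≤ N * y) :
    1 / (2 : ℝ) ^ (117 * y) ≤ A.error correct := by
  obtain ⟨D, K, hK, hD, hK1, hK2⟩ := exists_hasDualWitness hy hT hTy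
  exact (one_div_le_one_div_of_le (by positivity) hK2).trans
    (A.one_div_sq_le_error correct hcorrect hK hK1 hD)

theorem error_ge_of_queries_le_rpow {N : ℕ} {R : Type} (A : QuantumNetwork N R)
    (correct : (Fin N → Bool) → R → Prop)
    (hcorrect : ∀ X r, correct (fun _ => false) r → correct X r → X = fun _ => false)
    {α : ℝ} (hα : 0 ≤ α) (hT : A.queries < N)
    (hTα : (A.queries : ℝ) ≤ (N : ℝ) ^ ((1 / 2 : ℝ) + α)) :
    1 * (1 / (2 : ℝ) ^ (117 * (N : ℝ) ^ (2 * α))) ≤ A.error correct := by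
  rw [one_mul]
  have hN : (1 : ℝ) ≤ N := by exact_mod_cast (Nat.zero_le _).trans_lt hT
  refine error_ge_of_sq_queries_le A correct hcorrect (Real.one_le_rpow hN (by linarith)) hT ?_
  calc (A.queries : ℝ) ^ 2 ≤ ((N : ℝ) ^ ((1 / 2 : ℝ) + α)) ^ 2 :=
        pow_le_pow_left₀ (Nat.cast_nonneg _) hTα 2
    _ = (N : ℝ) ^ (1 + 2 * α) := by
        rw [← Real.rpow_natCast, ← Real.rpow_mul (by linarith)]
        congr 1
        push_cast
        ring
    _ = N * (N : ℝ) ^ (2 * α) := by rw [Real.rpow_add (by linarith), Real.rpow_one]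

theorem queries_ge_of_error_le {N : ℕ} (hN : 2 ≤ N) {R : Type} (A : QuantumNetwork N R)
    (correct : (Fin N → Bool) → R → Prop)
    (hcorrect : ∀ X r, correct (fun _ => false) r → correct X r → X = fun _ => false)
    (hε : A.error correct ≤ 1 / (2 : ℝ) ^ N) : 1 / 400 * (N : ℝ) ≤ A.queries := by
  have hN2 : (2 : ℝ) ≤ N := by exact_mod_cast hN
  rcases le_or_gt N 400 with hN400 | hN400
  · have hN400 : (N : ℝ) ≤ 400 := by exact_mod_cast hN400
    -- For `N ≤ 400` one query suffices. Without queries the degree-one witness of mass 2 gives `ε ≥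
    -- 1/2`, whereas `N ≥ 2` forces `ε ≤ 1/4`.
    have hT : 1 ≤ A.queries := by
      by_contra hT
      have h := A.one_sub_error_le correct hcorrect (hasDualWitness_one.mono (by omega))
        (not_le.mp hT)
      have : 1 / (2 : ℝ) ^ N ≤ 1 / 2 ^ 2 :=
        one_div_le_one_div_of_le (by norm_num) (pow_le_pow_right₀ (by norm_num) hN)
      linarith
    have hT : (1 : ℝ) ≤ A.queries := by exact_mod_cast hT
    linarith
  · have hN400 : (400 : ℝ) < N := by exact_mod_cast hN400
    by_contra hlt
    have hlt := not_le.mp hlt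
    have hT : A.queries < N := by
      have : (A.queries : ℝ) < N := by linarith
      exact_mod_cast this
    have hT0 : (0 : ℝ) ≤ A.queries := Nat.cast_nonneg _
    -- With `y = N / 400` the exponent `117 y` is below `N`, contradicting `ε ≤ 1 / 2^N`; `N > 400`
    -- ensures `y ≥ 1`.
    have h := error_ge_of_sq_queries_le A correct hcorrect (y := N / 400) (by linarith) hT
      (by nlinarith)
    have h2 := (one_div_le_one_div (by positivity) (by positivity)).mp (h.trans hε)
    rw [← Real.rpow_natCast, Real.rpow_le_rpow_left_iff (by norm_num)] at h2
    linarith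

end

theorem mainTheorem3 :
    (∃ c : ℝ, 0 < c ∧ ∃ C : ℝ, 0 < C ∧ ∀ (N : ℕ) (α : ℝ), 0 ≤ α →
      (∀ A : QuantumNetwork N (Option (Fin N)),
        A.queries < N → (A.queries : ℝ) ≤ (N : ℝ) ^ ((1 / 2 : ℝ) + α) →
          C * (1 / (2 : ℝ) ^ (c * (N : ℝ) ^ (2 * α))) ≤ A.error SearchCorrect) ∧
      (∀ A : QuantumNetwork N Bool,
        A.queries < N → (A.queries : ℝ) ≤ (N : ℝ) ^ ((1 / 2 : ℝ) + α) →
          C * (1 / (2 : ℝ) ^ (c * (N : ℝ) ^ (2 * α))) ≤ A.error OrCorrect)) ∧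
    (∃ κ : ℝ, 0 < κ ∧ ∀ N : ℕ, 2 ≤ N →
      (∀ A : QuantumNetwork N (Option (Fin N)),
        A.error SearchCorrect ≤ 1 / (2 : ℝ) ^ N → κ * (N : ℝ) ≤ (A.queries : ℝ)) ∧
      (∀ A : QuantumNetwork N Bool,
        A.error OrCorrect ≤ 1 / (2 : ℝ) ^ N → κ * (N : ℝ) ≤ (A.queries : ℝ))) := by
  refine ⟨⟨117, by norm_num, 1, one_pos, fun N α hα => ⟨fun A hT hTα => ?_, fun A hT hTα => ?_⟩⟩,
    1 / 400, by norm_num, fun N hN => ⟨fun A hε => ?_, fun A hε => ?_⟩⟩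
  · exact error_ge_of_queries_le_rpow A SearchCorrect searchCorrect_zero_unique hα hT hTα
  · exact error_ge_of_queries_le_rpow A OrCorrect orCorrect_zero_unique hα hT hTα
  · exact queries_ge_of_error_le hN A SearchCorrect searchCorrect_zero_unique hε
  · exact queries_ge_of_error_le hN A OrCorrect orCorrect_zero_unique hε
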